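/- Let $(M,g)$ be a smooth Riemannian manifold of dimension $4$ (without boundary, not necessarily connected or complete), with Levi-Civita connection $D$. A smooth function $f:M\to\mathbb{R}$ is called strictly convex if its Hessian $D_iD_jf$ is positive definite at every point of $M$. A smooth vector field $\xi$ on $M$ is a Killing field if $D_i\xi_j+D_j\xi_i=0$. A bolt of $\xi$ is a connected component of the fixed-point set $\{x\in M:\xi(x)=0\}$ of $\xi$ that is a two-dimensional embedded smooth submanifold of $M$ (without boundary); the bolt is called closed if it is compact. If $(M,g)$ admits a strictly convex function, then no Killing field on $(M,g)$ has a closed bolt. -/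

import Mathlib

open Bundle FiberBundle VectorField
open scoped Manifold ContDiff Topology

noncomputable section
namespace Riemannian
section LeviCivita

set_option linter.unusedSectionVars false

variable {E : Type*} [NormedAddCommGroup E] [NormedSpace ℝ E] [FiniteDimensional ℝ E]
  {H : Type*} [TopologicalSpace H] {I : ModelWithCorners ℝ E H}
  {M : Type*} [TopologicalSpace M] [ChartedSpace H M] [IsManifold I ∞ M]
  [RiemannianBundle (fun x : M ↦ TangentSpace I x)]
  [IsContMDiffRiemannianBundle I ∞ E (fun x : M ↦ TangentSpace I x)]

theorem finiteDimensional_tangentSpace (x : M) : FiniteDimensional ℝ (TangentSpace I x) :=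
  VectorBundle.finiteDimensional ℝ E (TangentSpace I) x

theorem mdifferentiableAt_inner {X Y : Π x : M, TangentSpace I x} {x : M}
    (hX : MDiffAt (T% X) x) (hY : MDiffAt (T% Y) x) :
    MDiffAt (fun y ↦ (inner ℝ (X y) (Y y) : ℝ)) x :=
  MDifferentiableAt.inner_bundle (IB := I) (F := E) (E := fun x : M ↦ TangentSpace I x) hX hY

/-- The Koszul expression, equal to `g(∇_X Y, Z)` at `x` for the Levi-Civita connection `∇`. -/
def koszul (X Y Z : Π x : M, TangentSpace I x) (x : M) : ℝ :=
  (1 / 2 : ℝ) *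
    (d% (fun y ↦ (inner ℝ (Y y) (Z y) : ℝ)) x (X x)
      + d% (fun y ↦ (inner ℝ (X y) (Z y) : ℝ)) x (Y x)
      - d% (fun y ↦ (inner ℝ (X y) (Y y) : ℝ)) x (Z x)
      + inner ℝ (mlieBracket I X Y x) (Z x)
      - inner ℝ (mlieBracket I X Z x) (Y x)
      - inner ℝ (mlieBracket I Y Z x) (X x))

theorem koszul_tensorial_left {Y Z : Π x : M, TangentSpace I x} {x : M}
    (hY : MDiffAt (T% Y) x) (hZ : MDiffAt (T% Z) x) :
    TensorialAt I E (fun X ↦ koszul X Y Z x) x where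
  smul {g X} hg hX := by
    simp [koszul, inner_smul_left, inner_smul_right,
      mvfderiv_fun_mul hg (mdifferentiableAt_inner hX hZ),
      mvfderiv_fun_mul hg (mdifferentiableAt_inner hX hY),
      mlieBracket_smul_left hg hX, inner_add_left]
    ring
  add {X X'} hX hX' := by
    simp [koszul, inner_add_left, inner_add_right,
      mvfderiv_fun_add (mdifferentiableAt_inner hX hZ) (mdifferentiableAt_inner hX' hZ),
      mvfderiv_fun_add (mdifferentiableAt_inner hX hY) (mdifferentiableAt_inner hX' hY),
      mlieBracket_add_left hX hX']
    ring

theorem koszul_tensorial_right {X Y : Π x : M, TangentSpace I x} {x : M}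
    (hX : MDiffAt (T% X) x) (hY : MDiffAt (T% Y) x) :
    TensorialAt I E (fun Z ↦ koszul X Y Z x) x where
  smul {g Z} hg hZ := by
    simp [koszul, inner_smul_right, mvfderiv_fun_mul hg (mdifferentiableAt_inner hX hZ),
      mvfderiv_fun_mul hg (mdifferentiableAt_inner hY hZ), inner_smul_left,
      mlieBracket_smul_right hg hZ, inner_add_left, real_inner_comm (Z x)]
    ring
  add {Z Z'} hZ hZ' := by
    simp [koszul, inner_add_left, inner_add_right,
      mvfderiv_fun_add (mdifferentiableAt_inner hX hZ) (mdifferentiableAt_inner hX hZ'),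
      mvfderiv_fun_add (mdifferentiableAt_inner hY hZ) (mdifferentiableAt_inner hY hZ'),
      mlieBracket_add_right hZ hZ']
    ring

open Classical in
/-- The covariant derivative `v ↦ ∇_v Y` at `x`: the vector dual to the Koszul expression
(junk value `0` if `Y` is not differentiable at `x`). -/
def leviCivitaFun (Y : Π x : M, TangentSpace I x) (x : M) :
    TangentSpace I x →L[ℝ] TangentSpace I x :=
  if hY : MDiffAt (T% Y) x then
    have : FiniteDimensional ℝ (TangentSpace I x) := finiteDimensional_tangentSpace x
    have : CompleteSpace (TangentSpace I x) := FiniteDimensional.complete ℝ _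
    LinearMap.toContinuousLinearMap
      { toFun v := (InnerProductSpace.toDual ℝ (TangentSpace I x)).symm
          (TensorialAt.mkHom₂ (fun X Z ↦ koszul X Y Z x) x
            (fun _ hZ ↦ koszul_tensorial_left hY hZ) (fun _ hX ↦ koszul_tensorial_right hX hY) v)
        map_add' v w := by simp
        map_smul' c v := by simp }
  else 0

theorem inner_leviCivitaFun {X Y Z : Π x : M, TangentSpace I x} {x : M}
    (hX : MDiffAt (T% X) x) (hY : MDiffAt (T% Y) x) (hZ : MDiffAt (T% Z) x) :
    inner ℝ (leviCivitaFun Y x (X x)) (Z x) = koszul X Y Z x := by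
  have : FiniteDimensional ℝ (TangentSpace I x) := finiteDimensional_tangentSpace x
  have : CompleteSpace (TangentSpace I x) := FiniteDimensional.complete ℝ _
  simp only [leviCivitaFun, hY, dif_pos]
  simp
  exact TensorialAt.mkHom₂_apply _ _ hX hZ

theorem eq_of_inner {x : M} {u v : TangentSpace I x}
    (h : ∀ Z : Π x : M, TangentSpace I x, MDiffAt (T% Z) x → inner ℝ u (Z x) = inner ℝ v (Z x)) :
    u = v :=
  ext_inner_right ℝ fun w ↦ by
    simpa using h (extend E w) (mdifferentiableAt_extend I E w)

theorem isCovariantDerivativeOn_leviCivitaFun :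
    IsCovariantDerivativeOn E (leviCivitaFun (I := I) (M := M)) Set.univ where
  add {Y Y' x} hY hY' _ := by
    ext1 v
    refine eq_of_inner fun Z hZ ↦ ?_
    have hX := mdifferentiableAt_extend I E v
    rw [← extend_apply_self (F := E) v, add_apply, inner_add_left,
      inner_leviCivitaFun hX (mdifferentiableAt_add_section hY hY') hZ,
      inner_leviCivitaFun hX hY hZ, inner_leviCivitaFun hX hY' hZ]
    simp [koszul, inner_add_left, inner_add_right,
      mvfderiv_fun_add (mdifferentiableAt_inner hY hZ) (mdifferentiableAt_inner hY' hZ),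
      mvfderiv_fun_add (mdifferentiableAt_inner hX hY) (mdifferentiableAt_inner hX hY'),
      mlieBracket_add_left hY hY', mlieBracket_add_right hY hY']
    ring
  leibniz {Y g x} hY hg _ := by
    ext1 v
    refine eq_of_inner fun Z hZ ↦ ?_
    have hX := mdifferentiableAt_extend I E v
    rw [← extend_apply_self (F := E) v, add_apply, inner_add_left, 
      inner_leviCivitaFun hX (hg.smul_section hY) hZ]
    simp only [smul_apply, ContinuousLinearMap.smulRight_apply,
      inner_smul_left, inner_leviCivitaFun hX hY hZ]
    simp [koszul, inner_add_left, inner_smul_left, inner_smul_right, 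
      mvfderiv_fun_mul hg (mdifferentiableAt_inner hY hZ),
      mvfderiv_fun_mul hg (mdifferentiableAt_inner hX hY), 
      mlieBracket_smul_left hg hY, mlieBracket_smul_right hg hY, real_inner_comm (Y x)]
    ring

/-- The Levi-Civita connection of a Riemannian manifold; `leviCivita I M Y x v` is `∇_v Y` at `x`.
It is torsion-free and metric, as shown below. -/
def leviCivita (I : ModelWithCorners ℝ E H) (M : Type*) [TopologicalSpace M] [ChartedSpace H M]
    [IsManifold I ∞ M] [RiemannianBundle (fun x : M ↦ TangentSpace I x)]
    [IsContMDiffRiemannianBundle I ∞ E (fun x : M ↦ TangentSpace I x)] :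
    CovariantDerivative I E (fun x : M ↦ TangentSpace I x) where
  toFun := leviCivitaFun
  isCovariantDerivativeOnUniv := isCovariantDerivativeOn_leviCivitaFun

theorem torsion_leviCivita : (leviCivita I M).torsion = 0 := by
  rw [CovariantDerivative.torsion_eq_zero_iff]
  intro X Y x hX hY
  refine eq_of_inner fun Z hZ ↦ ?_
  rw [inner_sub_left]
  change inner ℝ (leviCivitaFun Y x (X x)) (Z x) - inner ℝ (leviCivitaFun X x (Y x)) (Z x) = _
  rw [inner_leviCivitaFun hX hY hZ, inner_leviCivitaFun hY hX hZ]
  have h : (fun y ↦ (inner ℝ (X y) (Y y) : ℝ)) = fun y ↦ inner ℝ (Y y) (X y) :=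
    funext fun y ↦ real_inner_comm _ _
  simp only [koszul, h, mlieBracket_swap_apply (V := Y) (W := X), inner_neg_left]
  ring

theorem leviCivita_metric {X Y Z : Π x : M, TangentSpace I x} {x : M}
    (hX : MDiffAt (T% X) x) (hY : MDiffAt (T% Y) x) (hZ : MDiffAt (T% Z) x) :
    d% (fun y ↦ (inner ℝ (Y y) (Z y) : ℝ)) x (X x) =
      inner ℝ (leviCivita I M Y x (X x)) (Z x) + inner ℝ (Y x) (leviCivita I M Z x (X x)) := by
  have h1 := inner_leviCivitaFun hX hY hZ
  have h2 := inner_leviCivitaFun hX hZ hY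
  rw [real_inner_comm] at h2
  have h : (fun y ↦ (inner ℝ (Z y) (Y y) : ℝ)) = fun y ↦ inner ℝ (Y y) (Z y) :=
    funext fun y ↦ real_inner_comm _ _
  change _ = inner ℝ (leviCivitaFun Y x (X x)) (Z x) + inner ℝ (Y x) (leviCivitaFun Z x (X x))
  rw [h1, h2]
  simp only [koszul, h, mlieBracket_swap_apply (V := Z) (W := Y), inner_neg_left]
  ring

/-- The Hessian `(D D f)(v, w) = v (W f) - (D_v W) f` of `f` at `x`, where `D` is the Levi-Civita
connection and `W` is the vector field near `x` with `W x = w` and constant coefficients in the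
chart at `x`. -/
def hessian (I : ModelWithCorners ℝ E H) [IsManifold I ∞ M]
    [RiemannianBundle (fun x : M ↦ TangentSpace I x)]
    [IsContMDiffRiemannianBundle I ∞ E (fun x : M ↦ TangentSpace I x)]
    (f : M → ℝ) (x : M) (v w : TangentSpace I x) : ℝ :=
  mvfderiv I (fun y ↦ mvfderiv I f y (extend E w y)) x v
    - mvfderiv I f x (leviCivita I M (extend E w) x v)

theorem mdifferentiableAt_mvfderiv_apply {f : M → ℝ} (hf : ContMDiff I 𝓘(ℝ) ∞ f)
    {W : Π x : M, TangentSpace I x} {x : M} (hW : MDiffAt (T% W) x) :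
    MDiffAt (fun y ↦ mvfderiv I f y (W y)) x := by
  have h1 := (ContMDiffAt.mfderiv_const (m := 1) (hf.contMDiffAt (x := x))
    (by norm_cast)).mdifferentiableAt one_ne_zero
  have h2 := MDifferentiableAt.clm_apply_of_inCoordinates (b₁ := fun y ↦ y) (b₂ := f)
    (ϕ := fun y ↦ mfderiv I 𝓘(ℝ) f y) (v := W) (E₁ := fun x : M ↦ TangentSpace I x)
    (E₂ := fun x : ℝ ↦ TangentSpace 𝓘(ℝ) x) (F₁ := E) (F₂ := ℝ) h1 hW
    (hf.mdifferentiable (by simp) x)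
  rw [mdifferentiableAt_totalSpace] at h2
  simpa [mvfderiv] using! h2.2

/-- The Hessian does not depend on the vector field that extends its second argument. -/
theorem hessian_apply {f : M → ℝ} (hf : ContMDiff I 𝓘(ℝ) ∞ f)
    {W : Π x : M, TangentSpace I x} {x : M} (hW : MDiffAt (T% W) x) (v : TangentSpace I x) :
    hessian I f x v (W x) =
      mvfderiv I (fun y ↦ mvfderiv I f y (W y)) x v - mvfderiv I f x (leviCivita I M W x v) := by
  have hT : TensorialAt I E (fun W : Π x : M, TangentSpace I x ↦
      mvfderiv I (fun y ↦ mvfderiv I f y (W y)) x v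
        - mvfderiv I f x (leviCivita I M W x v)) x :=
    { smul := fun {g W} hg hW ↦ by
        simp [(leviCivita I M).isCovariantDerivativeOn.leibniz hW hg (Set.mem_univ x),
          mvfderiv_fun_mul hg (mdifferentiableAt_mvfderiv_apply hf hW)]
        ring
      add := fun {W W'} hW hW' ↦ by
        simp [(leviCivita I M).isCovariantDerivativeOn.add hW hW' (Set.mem_univ x),
          mvfderiv_fun_add (mdifferentiableAt_mvfderiv_apply hf hW)
            (mdifferentiableAt_mvfderiv_apply hf hW')]
        ring }
  exact hT.pointwise (mdifferentiableAt_extend I E _) hW (by simp)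

/-- A strictly convex function on a Riemannian manifold: a smooth function with positive definite
Hessian. -/
def IsStrictlyConvex (I : ModelWithCorners ℝ E H) [IsManifold I ∞ M]
    [RiemannianBundle (fun x : M ↦ TangentSpace I x)]
    [IsContMDiffRiemannianBundle I ∞ E (fun x : M ↦ TangentSpace I x)] (f : M → ℝ) : Prop :=
  ContMDiff I 𝓘(ℝ) ∞ f ∧ ∀ (x : M) (v : TangentSpace I x), v ≠ 0 → 0 < hessian I f x v v

/-- A Killing vector field: a smooth vector field `ξ` with `D_i ξ_j + D_j ξ_i = 0`, where `D` is
the Levi-Civita connection. -/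
def IsKillingField (ξ : Π x : M, TangentSpace I x) : Prop :=
  ContMDiff I I.tangent ∞ (fun x ↦ (⟨x, ξ x⟩ : TangentBundle I M)) ∧
    ∀ (x : M) (v w : TangentSpace I x),
      inner ℝ (leviCivita I M ξ x v) w + inner ℝ v (leviCivita I M ξ x w) = 0

end LeviCivita

section Bolt

variable {E : Type*} [NormedAddCommGroup E] [NormedSpace ℝ E]
  {H : Type*} [TopologicalSpace H] {M : Type*} [TopologicalSpace M] [ChartedSpace H M]

/-- `S` is an embedded smooth `k`-dimensional submanifold (without boundary) of `M`: with the
subspace topology, it carries a smooth structure for which the inclusion is a smooth embedding. -/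
def IsEmbeddedSubmanifold (I : ModelWithCorners ℝ E H) (k : ℕ) (S : Set M) : Prop :=
  ∃ _ : ChartedSpace (EuclideanSpace ℝ (Fin k)) S,
    IsManifold (𝓡 k) ∞ S ∧ Manifold.IsSmoothEmbedding (𝓡 k) I ∞ (Subtype.val : S → M)

/-- A bolt of the vector field `ξ`: a two-dimensional connected component of the fixed-point set of
(the flow of) `ξ`, that is, of the set of zeros of `ξ`. -/
def IsBolt {I : ModelWithCorners ℝ E H} (ξ : Π x : M, TangentSpace I x) (S : Set M) : Prop :=
  (∃ p, ξ p = 0 ∧ S = connectedComponentIn {x | ξ x = 0} p) ∧ IsEmbeddedSubmanifold I 2 S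

end Bolt

end Riemannian

end

/-! ### Second-derivative tests in normed spaces. -/

section Calculus

set_option maxSynthPendingDepth 3

variable {E : Type*} [NormedAddCommGroup E] [NormedSpace ℝ E]
  {W : Type*} [NormedAddCommGroup W] [NormedSpace ℝ W]

/-! A bolt is totally geodesic, so the ambient Hessian of a function, restricted to tangent vectors
of the bolt, is the Hessian of its restriction. On a compact bolt a strictly convex `f` attains a
maximum at some `p`, where the Hessian of the restriction is nonpositive: a contradiction.

Only a pointwise form of this is needed, and it is proved in the chart at `p`
(`IsKillingOn.exists_hessian_nonpos`). Let `A` be the derivative of the field at `p`; it is skew and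
kills the tangent plane of the bolt. If `A ≠ 0`, dimension four forces the range of `A` to be the
normal plane, so the gradient of `f`, being normal at the maximum, is `A w` for some `w`
(`exists_apply_eq_of_skew`). Differentiating `X ∘ c = 0` twice along a curve `c` in the bolt,
together with the derivative of the Killing equation, shows that the covariant acceleration of `c`
is orthogonal to `A w`. Hence `(f ∘ c)''` is exactly the Hessian on `c'`.

If `A = 0`, a Killing field with vanishing 1-jet vanishes nearby (`IsKillingOn.eventually_eq_zero`);
the bolt then contains a neighbourhood of `p`, and `p` is a local maximum of `f` on `M`. The passage
to charts is `isKillingOn_chart` and `hessian_chart`. -/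

theorem deriv_deriv_comp_curve {F : E → W} {c : ℝ → E} {t : ℝ}
    (hF : ContDiffAt ℝ 2 F (c t)) (hc : ContDiffAt ℝ 2 c t) :
    deriv (deriv (F ∘ c)) t =
      fderiv ℝ (fderiv ℝ F) (c t) (deriv c t) (deriv c t) + fderiv ℝ F (c t) (deriv (deriv c) t) := by
  have h1 : deriv (F ∘ c) =ᶠ[𝓝 t] fun s ↦ fderiv ℝ F (c s) (deriv c s) := by
    have hF' := hc.continuousAt.eventually (hF.eventually (by simp))
    filter_upwards [hF', hc.eventually (by simp)] with s hs1 hs2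
    exact fderiv_comp_deriv s (hs1.differentiableAt (by simp)) (hs2.differentiableAt (by simp))
  have hcd : HasDerivAt c (deriv c t) t := (hc.differentiableAt (by simp)).hasDerivAt
  have hcdd : HasDerivAt (deriv c) (deriv (deriv c) t) t := by
    have : ContDiffAt ℝ 1 (deriv c) t := by
      simpa [Function.comp_def] using
        (hc.fderiv_right (m := 1) (by norm_num)).clm_apply contDiffAt_const (g := fun _ ↦ (1 : ℝ))
    exact (this.differentiableAt (by simp)).hasDerivAt
  have hFd : HasFDerivAt (fderiv ℝ F) (fderiv ℝ (fderiv ℝ F) (c t)) (c t) :=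
    ((hF.fderiv_right (m := 1) (by norm_num)).differentiableAt (by simp)).hasFDerivAt
  rw [h1.deriv_eq]
  exact ((hFd.comp_hasDerivAt t hcd).clm_apply hcdd).deriv

/-- A positive second derivative at the critical point would make it a local minimum as well, so `f`
would be locally constant and its second derivative zero. -/
theorem deriv_deriv_nonpos_of_isLocalMax {f : ℝ → ℝ} {t : ℝ} (h : IsLocalMax f t)
    (hf : ContinuousAt f t) : deriv (deriv f) t ≤ 0 := by
  by_contra! hpos
  have hmin := isLocalMin_of_deriv_deriv_pos hpos h.deriv_eq_zero hf
  have hconst : f =ᶠ[𝓝 t] fun _ ↦ f t := by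
    filter_upwards [h, hmin] with s h1 h2 using le_antisymm h1 h2
  have := hconst.deriv.deriv_eq
  simp [this] at hpos

theorem fderiv_fderiv_nonpos_of_isLocalMax {F : E → ℝ} {x : E} (h : IsLocalMax F x)
    (hF : ContDiffAt ℝ 2 F x) (v : E) : fderiv ℝ (fderiv ℝ F) x v v ≤ 0 := by
  have hc : ContDiff ℝ 2 fun s : ℝ ↦ x + s • v := by fun_prop
  have hc' : deriv (fun s : ℝ ↦ x + s • v) = fun _ ↦ v := by
    ext1 s
    simpa using (((hasDerivAt_id s).smul_const v).const_add x).deriv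
  have hx : x + (0 : ℝ) • v = x := by simp
  have hmax : IsLocalMax (F ∘ fun s : ℝ ↦ x + s • v) 0 := by
    apply IsLocalMax.comp_continuous (g := fun s : ℝ ↦ x + s • v) (by simpa using h)
    exact hc.continuous.continuousAt
  have h2 := deriv_deriv_comp_curve (F := F) (t := 0) (by simpa using hF) hc.contDiffAt
  rw [hc'] at h2
  simp only [hx, deriv_const, map_zero, add_zero] at h2
  rw [← h2]
  refine deriv_deriv_nonpos_of_isLocalMax hmax ?_
  exact ContinuousAt.comp (by simpa using hF.continuousAt) hc.continuous.continuousAt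

/-! ### The Killing equation in coordinates and its prolongation to a second-order system. -/

/-- `X` satisfies the Killing equation on `U` for the metric with components `g`. -/
structure IsKillingOn (g : E → E →L[ℝ] E →L[ℝ] ℝ) (X : E → E) (U : Set E) : Prop where
  isOpen : IsOpen U
  contDiffOn_metric : ContDiffOn ℝ ∞ g U
  contDiffOn_field : ContDiffOn ℝ ∞ X U
  symm : ∀ x ∈ U, ∀ u v, g x u v = g x v u
  pos : ∀ x ∈ U, ∀ u, u ≠ 0 → 0 < g x u u
  killing : ∀ x ∈ U, ∀ u v,
    fderiv ℝ g x (X x) u v + g x (fderiv ℝ X x u) v + g x u (fderiv ℝ X x v) = 0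

namespace IsKillingOn

variable {g : E → E →L[ℝ] E →L[ℝ] ℝ} {X : E → E} {U : Set E} {x : E}

theorem contDiffAt_metric (h : IsKillingOn g X U) (hx : x ∈ U) : ContDiffAt ℝ ∞ g x :=
  h.contDiffOn_metric.contDiffAt (h.isOpen.mem_nhds hx)

theorem contDiffAt_field (h : IsKillingOn g X U) (hx : x ∈ U) : ContDiffAt ℝ ∞ X x :=
  h.contDiffOn_field.contDiffAt (h.isOpen.mem_nhds hx)

/-- The derivative of the Killing equation. -/
theorem fderiv_killing (h : IsKillingOn g X U) (hx : x ∈ U) (z u v : E) :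
    fderiv ℝ (fderiv ℝ g) x z (X x) u v + fderiv ℝ g x (fderiv ℝ X x z) u v
      + fderiv ℝ g x z (fderiv ℝ X x u) v + g x (fderiv ℝ (fderiv ℝ X) x z u) v
      + fderiv ℝ g x z u (fderiv ℝ X x v) + g x u (fderiv ℝ (fderiv ℝ X) x z v) = 0 := by
  have hg := ((h.contDiffAt_metric hx).differentiableAt (by simp)).hasFDerivAt
  have hX := ((h.contDiffAt_field hx).differentiableAt (by simp)).hasFDerivAt
  have hDg := (((h.contDiffAt_metric hx).fderiv_right (m := ∞) (by simp)).differentiableAt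
    (by simp)).hasFDerivAt
  have hDX := (((h.contDiffAt_field hx).fderiv_right (m := ∞) (by simp)).differentiableAt
    (by simp)).hasFDerivAt
  have hu : HasFDerivAt (fun _ : E ↦ u) (0 : E →L[ℝ] E) x := hasFDerivAt_const u x
  have hv : HasFDerivAt (fun _ : E ↦ v) (0 : E →L[ℝ] E) x := hasFDerivAt_const v x
  have h1 := ((((hDg.clm_apply hX).clm_apply hu).clm_apply hv).add
    ((hg.clm_apply (hDX.clm_apply hu)).clm_apply hv)).add
    ((hg.clm_apply hu).clm_apply (hDX.clm_apply hv))
  have h2 : HasFDerivAt (fun _ : E ↦ (0 : ℝ)) (0 : E →L[ℝ] ℝ) x := hasFDerivAt_const _ _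
  have h3 := h1.unique (h2.congr_of_eventuallyEq (by
    filter_upwards [h.isOpen.mem_nhds hx] with y hy using h.killing y hy u v))
  have h4 := congrArg (fun T : E →L[ℝ] ℝ ↦ T z) h3
  simp at h4
  linarith


/-- Positive definiteness makes `g x`, as a map to the dual, injective, hence bounded below in
finite dimension; a small perturbation keeps half of the bound. This turns estimates on `g y v` into
estimates on `v`. -/
theorem eventually_norm_le [FiniteDimensional ℝ E] (h : IsKillingOn g X U) (hx : x ∈ U) :
    ∃ K : ℝ, 0 < K ∧ ∀ᶠ y in 𝓝 x, ∀ v, ‖v‖ ≤ K * ‖g y v‖ := by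
  obtain ⟨K, hK, hKg⟩ := LinearMap.exists_antilipschitzWith (g x).toLinearMap (by
    rw [LinearMap.ker_eq_bot']
    intro v hv
    by_contra hne
    have h1 := h.pos x hx v hne
    have h2 : g x v = 0 := hv
    simp [h2] at h1)
  have hK' : (0 : ℝ) < K := hK
  have hcont := (h.contDiffAt_metric hx).continuousAt
  have hnear := hcont.eventually (Metric.ball_mem_nhds (g x) (ε := 1 / (2 * K)) (by positivity))
  refine ⟨2 * K, by positivity, ?_⟩
  filter_upwards [hnear] with y hy v
  have h1 : ‖v‖ ≤ K * ‖g x v‖ := by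
    simpa [dist_eq_norm] using hKg.le_mul_dist v 0
  have h2 : ‖g x v‖ ≤ ‖g y v‖ + 1 / (2 * K) * ‖v‖ := by
    have h3 : ‖(g x - g y) v‖ ≤ 1 / (2 * K) * ‖v‖ := by
      refine (ContinuousLinearMap.le_opNorm _ v).trans ?_
      gcongr
      rw [dist_comm, dist_eq_norm] at hy
      exact hy.le
    calc ‖g x v‖ = ‖g y v + (g x - g y) v‖ := by simp
      _ ≤ ‖g y v‖ + ‖(g x - g y) v‖ := norm_add_le _ _
      _ ≤ _ := by gcongr
  have h4 : K * ‖g x v‖ ≤ K * ‖g y v‖ + ‖v‖ / 2 := by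
    calc K * ‖g x v‖ ≤ K * (‖g y v‖ + 1 / (2 * K) * ‖v‖) := by gcongr
      _ = _ := by field_simp
  linarith

theorem isSymmSndFDerivAt_field (h : IsKillingOn g X U) (hx : x ∈ U) :
    IsSymmSndFDerivAt ℝ X x :=
  (h.contDiffAt_field hx).isSymmSndFDerivAt (by simpa using ENat.LEInfty.out)

set_option synthInstance.maxHeartbeats 200000 in
/-- A Killing field satisfies a second order linear differential system. -/
theorem eventually_norm_fderiv_fderiv_le [FiniteDimensional ℝ E] (h : IsKillingOn g X U)
    (hx : x ∈ U) : ∃ K : ℝ, 0 ≤ K ∧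
      ∀ᶠ y in 𝓝 x, ‖fderiv ℝ (fderiv ℝ X) y‖ ≤ K * (‖X y‖ + ‖fderiv ℝ X y‖) := by
  obtain ⟨K, hK, hnorm⟩ := h.eventually_norm_le hx
  have hDg := (h.contDiffAt_metric hx).fderiv_right (m := ∞) (by simp)
  have hDDg := hDg.fderiv_right (m := ∞) (by simp)
  obtain ⟨B₁, hB₁⟩ : ∃ B₁, ∀ᶠ y in 𝓝 x, ‖fderiv ℝ g y‖ ≤ B₁ :=
    ⟨_, hDg.continuousAt.norm.eventually_le_const (lt_add_one _)⟩
  obtain ⟨B₂, hB₂⟩ : ∃ B₂, ∀ᶠ y in 𝓝 x, ‖fderiv ℝ (fderiv ℝ g) y‖ ≤ B₂ :=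
    ⟨_, hDDg.continuousAt.norm.eventually_le_const (lt_add_one _)⟩
  set B := max (max B₁ B₂) 0
  -- `9 / 2` is the factor `1 / 2` of `hformula` times three terms `L`, each bounded with constant
  -- `3 * B`.
  refine ⟨K * (9 / 2 * B), by positivity, ?_⟩
  filter_upwards [hnorm, hB₁, hB₂, h.isOpen.mem_nhds hx] with y hy hy₁ hy₂ hyU
  have hy₁' : ‖fderiv ℝ g y‖ ≤ B := hy₁.trans (by simp [B])
  have hy₂' : ‖fderiv ℝ (fderiv ℝ g) y‖ ≤ B := hy₂.trans (by simp [B])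
  set N := ‖X y‖ + ‖fderiv ℝ X y‖
  set L : E → E → E → ℝ := fun z u v ↦ fderiv ℝ (fderiv ℝ g) y z (X y) u v
      + fderiv ℝ g y (fderiv ℝ X y z) u v
      + fderiv ℝ g y z (fderiv ℝ X y u) v + fderiv ℝ g y z u (fderiv ℝ X y v) with hL
  have hbound (z u v : E) : ‖L z u v‖ ≤ 3 * B * N * (‖z‖ * ‖u‖ * ‖v‖) := by
    have h1 : ‖fderiv ℝ (fderiv ℝ g) y z (X y) u v‖ ≤ B * ‖z‖ * ‖X y‖ * ‖u‖ * ‖v‖ :=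
      ContinuousLinearMap.le_of_opNorm_le_of_le _ (ContinuousLinearMap.le_of_opNorm_le_of_le _
        (ContinuousLinearMap.le_of_opNorm_le_of_le _ (ContinuousLinearMap.le_of_opNorm_le_of_le _
          hy₂' le_rfl) le_rfl) le_rfl) le_rfl
    have h3 (a b c : E) : ‖fderiv ℝ g y a b c‖ ≤ B * ‖a‖ * ‖b‖ * ‖c‖ :=
      ContinuousLinearMap.le_of_opNorm_le_of_le _ (ContinuousLinearMap.le_of_opNorm_le_of_le _
        (ContinuousLinearMap.le_of_opNorm_le_of_le _ hy₁' le_rfl) le_rfl) le_rfl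
    have hX (a : E) : ‖fderiv ℝ X y a‖ ≤ ‖fderiv ℝ X y‖ * ‖a‖ := ContinuousLinearMap.le_opNorm _ _
    have hB : 0 ≤ B := le_max_right _ _
    have e1 : ‖fderiv ℝ g y (fderiv ℝ X y z) u v‖ ≤
        B * (‖fderiv ℝ X y‖ * ‖z‖) * ‖u‖ * ‖v‖ := (h3 _ _ _).trans (by gcongr; exact hX z)
    have e2 : ‖fderiv ℝ g y z (fderiv ℝ X y u) v‖ ≤
        B * ‖z‖ * (‖fderiv ℝ X y‖ * ‖u‖) * ‖v‖ := (h3 _ _ _).trans (by gcongr; exact hX u)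
    have e3 : ‖fderiv ℝ g y z u (fderiv ℝ X y v)‖ ≤
        B * ‖z‖ * ‖u‖ * (‖fderiv ℝ X y‖ * ‖v‖) := (h3 _ _ _).trans (by gcongr; exact hX v)
    refine (norm_add₄_le).trans ((add_le_add (add_le_add (add_le_add h1 e1) e2) e3).trans ?_)
    have h0 : 0 ≤ B * ‖X y‖ * (‖z‖ * ‖u‖ * ‖v‖) := by positivity
    simp only [N]
    linarith
  have hsymm := h.isSymmSndFDerivAt_field hyU
  -- The Koszul trick: the differentiated Killing equation is taken in three cyclic orders and
  -- combined with signs `+`, `+`, `-`. Symmetry of the second derivative of `X` cancels all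
  -- second-order terms but one, which is solved for in terms of the 1-jet of `X`.
  have hformula (z u v : E) : g y (fderiv ℝ (fderiv ℝ X) y z u) v =
      -(1 / 2) * (L z u v + L u v z - L v z u) := by
    have k1 := h.fderiv_killing hyU z u v
    have k2 := h.fderiv_killing hyU u v z
    have k3 := h.fderiv_killing hyU v z u
    have s1 := hsymm.eq z u
    have s2 := hsymm.eq u v
    have s3 := hsymm.eq z v
    rw [h.symm y hyU u] at k1
    rw [h.symm y hyU v, ← s1] at k2
    rw [h.symm y hyU z, ← s2, ← s3] at k3
    simp only [hL]
    linarith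
  refine ContinuousLinearMap.opNorm_le_bound₂ _ (by positivity) fun z u ↦ ?_
  refine (hy _).trans ?_
  have : ‖g y (fderiv ℝ (fderiv ℝ X) y z u)‖ ≤ 9 / 2 * B * N * (‖z‖ * ‖u‖) := by
    refine ContinuousLinearMap.opNorm_le_bound _ (by positivity) fun v ↦ ?_
    rw [hformula, norm_mul]
    have h1 := hbound z u v
    have h2 := hbound u v z
    have h3 := hbound v z u
    have h4 : ‖L z u v + L u v z - L v z u‖ ≤ ‖L z u v‖ + ‖L u v z‖ + ‖L v z u‖ :=
      (norm_sub_le _ _).trans (by gcongr; exact norm_add_le _ _)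
    norm_num
    norm_num at h1 h2 h3 h4
    linarith
  calc K * _ ≤ K * (9 / 2 * B * N * (‖z‖ * ‖u‖)) := by gcongr
    _ = _ := by ring

/-- A Killing field that vanishes at a point together with its derivative vanishes near it. -/
theorem eventually_eq_zero [FiniteDimensional ℝ E] (h : IsKillingOn g X U) (hx : x ∈ U)
    (hX : X x = 0) (hDX : fderiv ℝ X x = 0) : ∀ᶠ y in 𝓝 x, X y = 0 := by
  obtain ⟨K, hK, hbound⟩ := h.eventually_norm_fderiv_fderiv_le hx
  obtain ⟨r, hr, hball⟩ := Metric.eventually_nhds_iff_ball.1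
    (hbound.and (h.isOpen.eventually_mem hx))
  refine Metric.eventually_nhds_iff_ball.2 ⟨r, hr, fun y hy ↦ ?_⟩
  set c : ℝ → E := fun t ↦ x + t • (y - x)
  have hcball (t : ℝ) (ht : t ∈ Set.Icc (0 : ℝ) 1) : c t ∈ Metric.ball x r := by
    have := (convex_ball x r).add_smul_sub_mem (Metric.mem_ball_self hr) hy ht
    exact this
  have hc (t : ℝ) : HasDerivAt c (y - x) t := by
    simpa [c] using ((hasDerivAt_id t).smul_const (y - x)).const_add x
  have hY (t : ℝ) (ht : t ∈ Set.Icc (0 : ℝ) 1) :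
      HasDerivAt (fun t ↦ (X (c t), fderiv ℝ X (c t)))
        (fderiv ℝ X (c t) (y - x), fderiv ℝ (fderiv ℝ X) (c t) (y - x)) t := by
    have hs := h.contDiffAt_field (hball _ (hcball t ht)).2
    have h1 := (hs.differentiableAt (by simp)).hasFDerivAt
    have h2 := ((hs.fderiv_right (m := ∞) (by simp)).differentiableAt (by simp)).hasFDerivAt
    exact (h1.comp_hasDerivAt t (hc t)).prodMk (h2.comp_hasDerivAt t (hc t))
  -- Grönwall for the 1-jet `(X, DX)` along the segment from `x` to `y`. Its first component has
  -- derivative at most `‖y - x‖` times the norm of the jet, its second at most `2 * K * ‖y - x‖`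
  -- times it; the constant dominates both.
  have hzero := eq_zero_of_abs_deriv_le_mul_abs_self_of_eq_zero_right
    (K := (1 + 2 * K) * ‖y - x‖) (a := 0) (b := 1)
    (fun t ht ↦ (hY t ht).continuousAt.continuousWithinAt)
    (fun t ht ↦ (hY t (Set.Ico_subset_Icc_self ht)).hasDerivWithinAt)
    (by simp [c, hX, hDX]) (fun t ht ↦ ?_) 1 (by simp)
  · simpa [c] using congrArg Prod.fst hzero
  · have hb := (hball _ (hcball t (Set.Ico_subset_Icc_self ht))).1
    have h1 : ‖X (c t)‖ ≤ ‖(X (c t), fderiv ℝ X (c t))‖ := norm_fst_le (X (c t), fderiv ℝ X (c t))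
    have h2 : ‖fderiv ℝ X (c t)‖ ≤ ‖(X (c t), fderiv ℝ X (c t))‖ := norm_snd_le (X (c t), fderiv ℝ X (c t))
    set N := ‖(X (c t), fderiv ℝ X (c t))‖
    have hN : 0 ≤ N := norm_nonneg _
    refine norm_prod_le_iff.2 ⟨?_, ?_⟩
    · calc _ ≤ N * ‖y - x‖ := ContinuousLinearMap.le_of_opNorm_le _ h2 _
        _ ≤ (1 + 2 * K) * ‖y - x‖ * N := by nlinarith [mul_nonneg hK (mul_nonneg (norm_nonneg (y - x)) hN)]
    · calc _ ≤ (K * (N + N)) * ‖y - x‖ :=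
            ContinuousLinearMap.le_of_opNorm_le _ (hb.trans (by gcongr)) _
        _ ≤ (1 + 2 * K) * ‖y - x‖ * N := by nlinarith [mul_nonneg (norm_nonneg (y - x)) hN]

end IsKillingOn

/-! ### Linear algebra of skew endomorphisms in dimension four. -/

/-- A nonzero skew map has rank at least two, and here nullity at least two, so both equal two. By
skewness the functionals `g (A w)` annihilate the range of `L`; they form a space of dimension two,
as does the whole annihilator, so every `l` in the annihilator has this form. -/
theorem exists_apply_eq_of_skew [FiniteDimensional ℝ E] (hE : Module.finrank ℝ E = 4)
    {V : Type*} [AddCommGroup V] [Module ℝ V] (hV : Module.finrank ℝ V = 2)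
    {g : E →ₗ[ℝ] E →ₗ[ℝ] ℝ} (pos : ∀ u, u ≠ 0 → 0 < g u u) (symm : ∀ u v, g u v = g v u)
    {A : E →ₗ[ℝ] E} (skew : ∀ u v, g (A u) v + g u (A v) = 0) (hA : A ≠ 0)
    {L : V →ₗ[ℝ] E} (hL : Function.Injective L) (hAL : ∀ e, A (L e) = 0)
    {l : E →ₗ[ℝ] ℝ} (hl : ∀ e, l (L e) = 0) : ∃ w, ∀ z, l z = g (A w) z := by
  have hrange : Module.finrank ℝ (LinearMap.range L) = 2 := by
    rw [LinearMap.finrank_range_of_inj hL, hV]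
  have hle : LinearMap.range L ≤ LinearMap.ker A := by
    rintro _ ⟨e, rfl⟩
    exact hAL e
  -- If `A u ≠ 0`, then `A (A u)` is orthogonal to `A u`, and it is nonzero because `g (A (A u)) u =
  -- -g (A u) (A u)`. So the two are independent.
  have hrank : 2 ≤ Module.finrank ℝ (LinearMap.range A) := by
    obtain ⟨u, hu⟩ : ∃ u, A u ≠ 0 := by
      by_contra! h0
      exact hA (LinearMap.ext h0)
    have horth : g (A (A u)) (A u) = 0 := by
      have h1 := skew (A u) (A u)
      rw [symm (A u)] at h1
      linarith
    have hAA : A (A u) ≠ 0 := fun h0 ↦ by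
      have h1 := skew (A u) u
      have h2 := pos _ hu
      simp [h0] at h1
      linarith
    have hli : LinearIndependent ℝ ![(⟨A u, u, rfl⟩ : LinearMap.range A), ⟨A (A u), A u, rfl⟩] := by
      rw [LinearIndependent.pair_iff]
      intro s t hst
      have hst' : s • A u + t • A (A u) = 0 := congrArg Subtype.val hst
      have h1 : g (s • A u + t • A (A u)) (A u) = 0 := by simp [hst']
      have hs : s = 0 := by simpa [horth, (pos _ hu).ne'] using h1
      subst hs
      simpa [hAA] using hst'
    simpa using hli.fintype_card_le_finrank
  have hsum := LinearMap.finrank_range_add_finrank_ker A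
  have hker : Module.finrank ℝ (LinearMap.ker A) = 2 :=
    le_antisymm (by omega) (hrange ▸ Submodule.finrank_mono hle)
  set B : E →ₗ[ℝ] Module.Dual ℝ E := g ∘ₗ A with hB
  have hkerB : LinearMap.ker B = LinearMap.ker A := by
    refine le_antisymm (fun w hw ↦ ?_) (fun w hw ↦ ?_)
    · by_contra hne
      have h1 := pos (A w) hne
      have h2 : g (A w) = 0 := hw
      simp [h2] at h1
    · have h2 : A w = 0 := hw
      simp [B, h2]
  have hsumB := LinearMap.finrank_range_add_finrank_ker B
  have hann := Subspace.finrank_add_finrank_dualAnnihilator_eq (LinearMap.range L)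
  have hleB : LinearMap.range B ≤ (LinearMap.range L).dualAnnihilator := by
    rintro _ ⟨w, rfl⟩
    rw [Submodule.mem_dualAnnihilator]
    rintro _ ⟨e, rfl⟩
    have h1 := skew w (L e)
    simpa [hB, hAL e] using h1
  have heq := Submodule.eq_of_le_of_finrank_eq hleB (by rw [hkerB] at hsumB; omega)
  have hmem : l ∈ LinearMap.range B := by
    rw [heq, Submodule.mem_dualAnnihilator]
    rintro _ ⟨e, rfl⟩
    exact hl e
  obtain ⟨w, hw⟩ := hmem
  exact ⟨w, fun z ↦ by rw [← hw]; rfl⟩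

end Calculus

/-! ### The Hessian at a maximum along a surface of zeros. -/

section CriticalPoint

set_option maxSynthPendingDepth 3

variable {E : Type*} [NormedAddCommGroup E] [NormedSpace ℝ E] [FiniteDimensional ℝ E]
  {V : Type*} [NormedAddCommGroup V] [NormedSpace ℝ V]

/-- Along a surface of zeros of a Killing field in dimension four, a function that is maximal at a
point has a tangent vector `v` on which its Hessian is nonpositive. The vector `Γ` is the
Christoffel symbol applied to `v` and `v`. -/
theorem IsKillingOn.exists_hessian_nonpos {g : E → E →L[ℝ] E →L[ℝ] ℝ} {X : E → E} {U : Set E}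
    {x : E} (h : IsKillingOn g X U) (hx : x ∈ U)
    (hE : Module.finrank ℝ E = 4) (hV : Module.finrank ℝ V = 2)
    {F : E → ℝ} (hF : ContDiffAt ℝ 2 F x) {φ : V → E} {t : V} (hφ : ContDiffAt ℝ 2 φ t)
    (hφx : φ t = x) (hinj : Function.Injective (fderiv ℝ φ t)) (hXφ : ∀ᶠ s in 𝓝 t, X (φ s) = 0)
    (hmax : IsLocalMax (F ∘ φ) t) (hmax' : (∀ᶠ y in 𝓝 x, X y = 0) → IsLocalMax F x) :
    ∃ v ≠ 0, ∀ Γ, (∀ w, g x Γ w = fderiv ℝ g x v v w - 1 / 2 * fderiv ℝ g x w v v) →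
      fderiv ℝ (fderiv ℝ F) x v v - fderiv ℝ F x Γ ≤ 0 := by
  have hXx : X x = 0 := hφx ▸ hXφ.self_of_nhds
  have : Nontrivial V := Module.nontrivial_of_finrank_pos (R := ℝ) (by omega)
  obtain ⟨e, he⟩ := exists_ne (0 : V)
  have hv : fderiv ℝ φ t e ≠ 0 := fun h0 ↦ he (hinj (by simpa using h0))
  refine ⟨fderiv ℝ φ t e, hv, fun Γ hΓ ↦ ?_⟩
  -- In the degenerate case `x` is a critical point and local maximum of `F` itself, so the `Γ` term
  -- drops out and any `v` works.
  by_cases hA : fderiv ℝ X x = 0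
  · have hm := hmax' (h.eventually_eq_zero hx hXx hA)
    simpa [hm.fderiv_eq_zero] using fderiv_fderiv_nonpos_of_isLocalMax hm hF _
  have hφd := hφ.differentiableAt (by simp)
  have hXd := (h.contDiffAt_field hx).differentiableAt (by simp)
  have hAφ (e : V) : fderiv ℝ X x (fderiv ℝ φ t e) = 0 := by
    have h1 : fderiv ℝ (X ∘ φ) t = 0 := by
      have : X ∘ φ =ᶠ[𝓝 t] fun _ ↦ 0 := hXφ
      simp [this.fderiv_eq]
    rw [fderiv_comp t (by rwa [hφx]) hφd, hφx] at h1
    exact congrArg (fun T : V →L[ℝ] E ↦ T e) h1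
  have hFφ (e : V) : fderiv ℝ F x (fderiv ℝ φ t e) = 0 := by
    have h1 := hmax.fderiv_eq_zero
    rw [fderiv_comp t (by rw [hφx]; exact hF.differentiableAt (by simp)) hφd, hφx] at h1
    exact congrArg (fun T : V →L[ℝ] ℝ ↦ T e) h1
  obtain ⟨w, hw⟩ := exists_apply_eq_of_skew hE hV
    (g := ((ContinuousLinearMap.coeLM ℝ).comp (g x).toLinearMap))
    (A := (fderiv ℝ X x).toLinearMap) (L := (fderiv ℝ φ t).toLinearMap)
    (l := (fderiv ℝ F x).toLinearMap) (h.pos x hx) (h.symm x hx)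
    (fun u v ↦ by simpa [hXx] using h.killing x hx u v)
    (fun h0 ↦ hA (ContinuousLinearMap.coe_injective h0)) hinj hAφ hFφ
  replace hw (z : E) : fderiv ℝ F x z = g x (fderiv ℝ X x w) z := hw z
  set v := fderiv ℝ φ t e with hv_def
  have hline : ContDiff ℝ 2 fun s : ℝ ↦ t + s • e := by fun_prop
  have ht : t + (0 : ℝ) • e = t := by simp
  -- Any curve in the surface with velocity `v` will do; it need not be a geodesic, since its
  -- acceleration is controlled by differentiating `X ∘ c = 0` twice.
  set c : ℝ → E := fun s ↦ φ (t + s • e) with hc_def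
  have hc0 : c 0 = x := by simp [c, hφx]
  have hc : ContDiffAt ℝ 2 c 0 :=
    ContDiffAt.comp (g := φ) (f := fun s : ℝ ↦ t + s • e) 0 (by rwa [ht]) hline.contDiffAt
  have hc' : deriv c 0 = v := by
    have h1 : HasDerivAt (fun s : ℝ ↦ t + s • e) e 0 := by
      simpa using ((hasDerivAt_id (0 : ℝ)).smul_const e).const_add t
    have h2 : HasFDerivAt φ (fderiv ℝ φ t) (t + (0 : ℝ) • e) := by
      rw [ht]; exact hφd.hasFDerivAt
    exact (h2.comp_hasDerivAt (0 : ℝ) h1).deriv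
  have hlim : Filter.Tendsto (fun s : ℝ ↦ t + s • e) (𝓝 0) (𝓝 t) := by
    simpa [ht] using hline.continuous.tendsto 0
  have hFc := deriv_deriv_comp_curve (F := F) (by rwa [hc0]) hc
  have hXc := deriv_deriv_comp_curve (F := X)
    (by rw [hc0]; exact (h.contDiffAt_field hx).of_le ENat.LEInfty.out) hc
  rw [hc', hc0] at hFc hXc
  have hXc0 : deriv (deriv (X ∘ c)) 0 = 0 := by
    have h1 : X ∘ c =ᶠ[𝓝 0] fun _ ↦ 0 := hlim.eventually hXφ
    simp [h1.deriv.deriv_eq]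
  have hFc0 : deriv (deriv (F ∘ c)) 0 ≤ 0 := by
    refine deriv_deriv_nonpos_of_isLocalMax ?_
      (ContinuousAt.comp (by rw [hc0]; exact hF.continuousAt) hc.continuousAt)
    have : IsLocalMax (F ∘ φ) (t + (0 : ℝ) • e) := by rwa [ht]
    exact this.comp_continuous (g := fun s : ℝ ↦ t + s • e) hline.continuous.continuousAt
  rw [hXc0] at hXc
  rw [hFc, hw] at hFc0
  -- With `A` the derivative of `X` at `x`, it remains to see that `g (A w) c'' = -g (A w) Γ`.
  -- Skewness and `D²X(v, v) + A c'' = 0` give `g (A w) c'' = g w (D²X(v, v))`; `k1` and half of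
  -- `k2` eliminate `D²X(v, w)` and evaluate the latter as `-g Γ (A w)`.
  have hskew := h.killing x hx w (deriv (deriv c) 0)
  have k1 := h.fderiv_killing hx v v w
  have k2 := h.fderiv_killing hx w v v
  have hΓ' := hΓ (fderiv ℝ X x w)
  have hXc' := congrArg (fun z ↦ g x w z) hXc
  have hAv : fderiv ℝ X x v = 0 := hAφ e
  have hs := (h.isSymmSndFDerivAt_field hx).eq w v
  simp only [hXx, hAv, map_zero, zero_apply, map_add, zero_add, add_zero, hs] at hskew k1 k2 hXc'
  rw [h.symm x hx _ w] at k1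
  rw [h.symm x hx _ v] at k2
  rw [hw, h.symm x hx, hΓ']
  linarith

end CriticalPoint

/-! ### Metric, Killing fields and Hessian read in a chart. -/

namespace Riemannian
section Chart

set_option maxSynthPendingDepth 3
set_option linter.unusedSectionVars false

variable {E : Type*} [NormedAddCommGroup E] [NormedSpace ℝ E]
  {M : Type*} [TopologicalSpace M] [ChartedSpace E M] [IsManifold 𝓘(ℝ, E) ∞ M]

theorem contMDiffAt_chart_symm (p : M) {x : E} (hx : x ∈ (extChartAt 𝓘(ℝ, E) p).target) :
    ContMDiffAt 𝓘(ℝ, E) 𝓘(ℝ, E) ∞ (extChartAt 𝓘(ℝ, E) p).symm x :=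
  (contMDiffOn_extChartAt_symm p).contMDiffAt ((isOpen_extChartAt_target p).mem_nhds hx)

theorem isInvertible_mfderiv_chart_symm (p : M) {x : E}
    (hx : x ∈ (extChartAt 𝓘(ℝ, E) p).target) :
    (mfderiv 𝓘(ℝ, E) 𝓘(ℝ, E) (extChartAt 𝓘(ℝ, E) p).symm x).IsInvertible := by
  have : IsManifold 𝓘(ℝ, E) 1 M := .of_le (n := ∞) ENat.LEInfty.out
  have h := isInvertible_mfderivWithin_extChartAt_symm (I := 𝓘(ℝ, E)) hx
  rwa [modelWithCornersSelf_coe, Set.range_id, mfderivWithin_univ] at h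

/-- The differential of the inverse of the chart at `p`. -/
noncomputable def chartFrame (p : M) (x : E) :
    E →L[ℝ] TangentSpace 𝓘(ℝ, E) ((extChartAt 𝓘(ℝ, E) p).symm x) :=
  mfderiv 𝓘(ℝ, E) 𝓘(ℝ, E) (extChartAt 𝓘(ℝ, E) p).symm x

theorem isInvertible_chartFrame (p : M) {x : E} (hx : x ∈ (extChartAt 𝓘(ℝ, E) p).target) :
    (chartFrame p x).IsInvertible :=
  isInvertible_mfderiv_chart_symm p hx

/-- The vector field with constant coefficients `u` in the chart at `p`. -/
noncomputable def coordField (p : M) (u : E) (y : M) : TangentSpace 𝓘(ℝ, E) y :=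
  (trivializationAt E (TangentSpace 𝓘(ℝ, E)) p).symm y u

/-- The components of a vector field in the chart at `p`. -/
noncomputable def chartField (p : M) (ξ : Π x : M, TangentSpace 𝓘(ℝ, E) x) (x : E) : E :=
  (chartFrame p x).inverse (ξ ((extChartAt 𝓘(ℝ, E) p).symm x))

variable (p : M) {x : E}

theorem contMDiffAt_coordField (u : E) {y : M} (hy : y ∈ (chartAt E p).source) :
    ContMDiffAt 𝓘(ℝ, E) 𝓘(ℝ, E).tangent ∞
      (fun y ↦ (⟨y, coordField p u y⟩ : TangentBundle 𝓘(ℝ, E) M)) y := by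
  set t := trivializationAt E (TangentSpace 𝓘(ℝ, E)) p with ht
  have hyt : y ∈ t.baseSet := by simpa [t] using hy
  rw [t.contMDiffAt_section_iff hyt]
  refine (contMDiffAt_const (c := u)).congr_of_eventuallyEq ?_
  filter_upwards [t.open_baseSet.mem_nhds hyt] with z hz
  rw [coordField, ← ht, t.apply_mk_symm hz]

/-- This links two descriptions of the coordinate fields: the trivialization gives their smoothness
as sections, the differential of the inverse chart makes them computable. -/
theorem coordField_chart_symm (u : E) (hx : x ∈ (extChartAt 𝓘(ℝ, E) p).target) :
    coordField p u ((extChartAt 𝓘(ℝ, E) p).symm x) = chartFrame p x u := by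
  have : IsManifold 𝓘(ℝ, E) 1 M := .of_le (n := ∞) ENat.LEInfty.out
  have hy : (extChartAt 𝓘(ℝ, E) p).symm x ∈ (chartAt E p).source := by
    simpa using (extChartAt 𝓘(ℝ, E) p).map_target hx
  have h := TangentBundle.symmL_trivializationAt (I := 𝓘(ℝ, E)) hy
  rw [(extChartAt 𝓘(ℝ, E) p).right_inv hx, modelWithCornersSelf_coe, Set.range_id,
    mfderivWithin_univ] at h
  have h' : (trivializationAt E (TangentSpace 𝓘(ℝ, E)) p).symmL ℝ
    ((extChartAt 𝓘(ℝ, E) p).symm x) = chartFrame p x := h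
  rw [← h', Trivialization.symmL_apply _ (by simpa using hy)]
  rfl

theorem chartFrame_chartField (ξ : Π x : M, TangentSpace 𝓘(ℝ, E) x)
    (hx : x ∈ (extChartAt 𝓘(ℝ, E) p).target) :
    chartFrame p x (chartField p ξ x) = ξ ((extChartAt 𝓘(ℝ, E) p).symm x) :=
  ((isInvertible_chartFrame p hx).inverse_apply_eq.1 rfl).symm

theorem chartField_coordField (u : E) (hx : x ∈ (extChartAt 𝓘(ℝ, E) p).target) :
    chartField p (coordField p u) x = u := by
  rw [chartField, coordField_chart_symm p u hx]
  exact (isInvertible_chartFrame p hx).inverse_apply_eq.2 rfl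

theorem chartFrame_injective (hx : x ∈ (extChartAt 𝓘(ℝ, E) p).target) :
    Function.Injective (chartFrame p x) :=
  (isInvertible_chartFrame p hx).bijective.injective

theorem chartField_eq_zero_iff {ξ : Π x : M, TangentSpace 𝓘(ℝ, E) x}
    (hx : x ∈ (extChartAt 𝓘(ℝ, E) p).target) :
    chartField p ξ x = 0 ↔ ξ ((extChartAt 𝓘(ℝ, E) p).symm x) = 0 := by
  rw [← chartFrame_chartField p ξ hx]
  exact ⟨fun h ↦ by rw [h]; exact map_zero _,
    fun h ↦ chartFrame_injective p hx (h.trans (map_zero _).symm)⟩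

theorem mvfderiv_chartFrame {h : M → ℝ} (hx : x ∈ (extChartAt 𝓘(ℝ, E) p).target)
    (hh : MDifferentiableAt 𝓘(ℝ, E) 𝓘(ℝ) h ((extChartAt 𝓘(ℝ, E) p).symm x)) (u : E) :
    mvfderiv 𝓘(ℝ, E) h ((extChartAt 𝓘(ℝ, E) p).symm x) (chartFrame p x u) =
      fderiv ℝ (h ∘ (extChartAt 𝓘(ℝ, E) p).symm) x u := by
  have h1 := mvfderiv_comp_apply x hh
    ((contMDiffAt_chart_symm p hx).mdifferentiableAt (by simp)) u
  rw [mvfderiv, mfderiv_eq_fderiv] at h1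
  exact h1.symm

variable [FiniteDimensional ℝ E]

theorem contDiffAt_chartField {ξ : Π x : M, TangentSpace 𝓘(ℝ, E) x}
    (hx : x ∈ (extChartAt 𝓘(ℝ, E) p).target)
    (hξ : ContMDiffAt 𝓘(ℝ, E) 𝓘(ℝ, E).tangent ∞
      (fun x ↦ (⟨x, ξ x⟩ : TangentBundle 𝓘(ℝ, E) M)) ((extChartAt 𝓘(ℝ, E) p).symm x)) :
    ContDiffAt ℝ ∞ (chartField p ξ) x := by
  have : IsManifold 𝓘(ℝ, E) 1 M := .of_le (n := ∞) ENat.LEInfty.out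
  have : CompleteSpace E := FiniteDimensional.complete ℝ E
  have h := ContMDiffWithinAt.mpullback_vectorField_preimage (m := ∞) (n := ∞)
    (t := Set.univ) (hξ.contMDiffWithinAt)
    (contMDiffAt_chart_symm p hx) (isInvertible_mfderiv_chart_symm p hx) (by simp)
  rw [Set.preimage_univ, contMDiffWithinAt_univ] at h
  exact contMDiffAt_vectorSpace_iff_contDiffAt.1 h

/-- The Lie bracket with a coordinate vector field. -/
theorem mlieBracket_coordField {ξ : Π x : M, TangentSpace 𝓘(ℝ, E) x} (u : E)
    (hx : x ∈ (extChartAt 𝓘(ℝ, E) p).target)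
    (hξ : ContMDiffAt 𝓘(ℝ, E) 𝓘(ℝ, E).tangent ∞
      (fun x ↦ (⟨x, ξ x⟩ : TangentBundle 𝓘(ℝ, E) M)) ((extChartAt 𝓘(ℝ, E) p).symm x)) :
    mlieBracket 𝓘(ℝ, E) (coordField p u) ξ ((extChartAt 𝓘(ℝ, E) p).symm x) =
      chartFrame p x (fderiv ℝ (chartField p ξ) x u) := by
  have : CompleteSpace E := FiniteDimensional.complete ℝ E
  have : IsManifold 𝓘(ℝ, E) (minSmoothness ℝ 3) M := .of_le (n := ∞) (by simpa using ENat.LEInfty.out)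
  have hy : (extChartAt 𝓘(ℝ, E) p).symm x ∈ (chartAt E p).source := by
    simpa using (extChartAt 𝓘(ℝ, E) p).map_target hx
  -- The Lie bracket is natural under pullback by the inverse chart, and `chartField` is by
  -- definition this pullback; on `E` the first field becomes constant.
  have h := mpullback_mlieBracket (n := ∞)
    ((contMDiffAt_coordField p u hy).mdifferentiableAt (by simp))
    (hξ.mdifferentiableAt (by simp)) (contMDiffAt_chart_symm p hx)
    (by simpa using ENat.LEInfty.out)
  rw [← mlieBracketWithin_univ, ← mlieBracketWithin_univ, mlieBracketWithin_eq_lieBracketWithin] at h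
  have h' : chartField p (mlieBracket 𝓘(ℝ, E) (coordField p u) ξ) x =
    lieBracketWithin ℝ (chartField p (coordField p u)) (chartField p ξ) Set.univ x := h
  have hconst : chartField p (coordField p u) =ᶠ[𝓝 x] fun _ ↦ u := by
    filter_upwards [(isOpen_extChartAt_target p).mem_nhds hx] with z hz
    exact chartField_coordField p u hz
  rw [← chartFrame_chartField p (mlieBracket 𝓘(ℝ, E) (coordField p u) ξ) hx, h', lieBracketWithin_univ, lieBracket, hconst.fderiv_eq, hconst.eq_of_nhds]
  simp

variable [RiemannianBundle (fun x : M ↦ TangentSpace 𝓘(ℝ, E) x)]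

/-- The components of the metric in the chart at `p`. -/
noncomputable def chartMetric (p : M) (x : E) : E →L[ℝ] E →L[ℝ] ℝ :=
  (innerSL ℝ (E := TangentSpace 𝓘(ℝ, E) ((extChartAt 𝓘(ℝ, E) p).symm x))).bilinearComp
    (chartFrame p x) (chartFrame p x)

theorem chartMetric_apply (x u v : E) :
    chartMetric p x u v = inner ℝ (chartFrame p x u) (chartFrame p x v) := rfl

theorem inner_coordField_chart_symm (u v : E) (hx : x ∈ (extChartAt 𝓘(ℝ, E) p).target) :
    inner ℝ (coordField p u ((extChartAt 𝓘(ℝ, E) p).symm x))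
      (coordField p v ((extChartAt 𝓘(ℝ, E) p).symm x)) = chartMetric p x u v := by
  rw [coordField_chart_symm p u hx, coordField_chart_symm p v hx, chartMetric_apply]

variable [IsContMDiffRiemannianBundle 𝓘(ℝ, E) ∞ E (fun x : M ↦ TangentSpace 𝓘(ℝ, E) x)]

theorem contMDiffAt_inner_coordField (u v : E) (hx : x ∈ (extChartAt 𝓘(ℝ, E) p).target) :
    ContMDiffAt 𝓘(ℝ, E) 𝓘(ℝ) ∞ (fun y ↦ (inner ℝ (coordField p u y) (coordField p v y) : ℝ))
      ((extChartAt 𝓘(ℝ, E) p).symm x) := by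
  have hy : (extChartAt 𝓘(ℝ, E) p).symm x ∈ (chartAt E p).source := by
    simpa using (extChartAt 𝓘(ℝ, E) p).map_target hx
  exact ContMDiffAt.inner_bundle (IB := 𝓘(ℝ, E)) (F := E)
    (E := fun x : M ↦ TangentSpace 𝓘(ℝ, E) x)
    (contMDiffAt_coordField p u hy) (contMDiffAt_coordField p v hy)

theorem contDiffOn_chartMetric :
    ContDiffOn ℝ ∞ (chartMetric p) (extChartAt 𝓘(ℝ, E) p).target := by
  rw [contDiffOn_clm_apply]
  intro u
  rw [contDiffOn_clm_apply]
  intro v x hx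
  have h2 := ((contMDiffAt_inner_coordField p u v hx).comp x
    (contMDiffAt_chart_symm p hx)).contDiffAt
  exact h2.contDiffWithinAt.congr (fun z hz ↦ (inner_coordField_chart_symm p u v hz).symm)
    (inner_coordField_chart_symm p u v hx).symm

theorem mvfderiv_inner_coordField (u v w : E) (hx : x ∈ (extChartAt 𝓘(ℝ, E) p).target) :
    mvfderiv 𝓘(ℝ, E) (fun y ↦ (inner ℝ (coordField p u y) (coordField p v y) : ℝ))
      ((extChartAt 𝓘(ℝ, E) p).symm x) (chartFrame p x w) = fderiv ℝ (chartMetric p) x w u v := by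
  have hg : DifferentiableAt ℝ (chartMetric p) x :=
    ((contDiffOn_chartMetric p).contDiffAt
      ((isOpen_extChartAt_target p).mem_nhds hx)).differentiableAt (by simp)
  have heq : ((fun y ↦ (inner ℝ (coordField p u y) (coordField p v y) : ℝ)) ∘
      (extChartAt 𝓘(ℝ, E) p).symm) =ᶠ[𝓝 x] fun z ↦ chartMetric p z u v := by
    filter_upwards [(isOpen_extChartAt_target p).mem_nhds hx] with z hz
    exact inner_coordField_chart_symm p u v hz
  rw [mvfderiv_chartFrame p hx
    ((contMDiffAt_inner_coordField p u v hx).mdifferentiableAt (by simp)), heq.fderiv_eq]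
  have h1 := ((hg.hasFDerivAt.clm_apply (hasFDerivAt_const u x)).clm_apply
    (hasFDerivAt_const v x)).fderiv
  rw [h1]
  simp


/-- Symmetrizing the Koszul expression of `∇ξ` in two coordinate fields leaves the Lie derivative of
the metric: the derivative of the metric along `ξ`, plus brackets of coordinate fields with `ξ`,
which are the partial derivatives of its components. -/
theorem isKillingOn_chart {ξ : Π x : M, TangentSpace 𝓘(ℝ, E) x} (hξ : IsKillingField ξ) :
    IsKillingOn (chartMetric p) (chartField p ξ) (extChartAt 𝓘(ℝ, E) p).target where
  isOpen := isOpen_extChartAt_target p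
  contDiffOn_metric := contDiffOn_chartMetric p
  contDiffOn_field _ hx := (contDiffAt_chartField p hx (hξ.1 _)).contDiffWithinAt
  symm x _ u v := by
    rw [chartMetric_apply, chartMetric_apply, real_inner_comm]
  pos x hx u hu := by
    rw [chartMetric_apply]
    refine real_inner_self_pos.2 fun h0 ↦ hu (chartFrame_injective p hx (h0.trans (map_zero _).symm))
  killing x hx u v := by
    have hy : (extChartAt 𝓘(ℝ, E) p).symm x ∈ (chartAt E p).source := by
      simpa using (extChartAt 𝓘(ℝ, E) p).map_target hx
    have hu := (contMDiffAt_coordField p u hy).mdifferentiableAt (by simp)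
    have hv := (contMDiffAt_coordField p v hy).mdifferentiableAt (by simp)
    have hξ' := (hξ.1 ((extChartAt 𝓘(ℝ, E) p).symm x)).mdifferentiableAt (by simp)
    have key := hξ.2 _ (coordField p u ((extChartAt 𝓘(ℝ, E) p).symm x))
      (coordField p v ((extChartAt 𝓘(ℝ, E) p).symm x))
    rw [real_inner_comm (leviCivita _ M ξ _ _)] at key
    have h1 := inner_leviCivitaFun hu hξ' hv
    have h2 := inner_leviCivitaFun hv hξ' hu
    have key' : koszul (coordField p u) ξ (coordField p v) ((extChartAt 𝓘(ℝ, E) p).symm x)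
        + koszul (coordField p v) ξ (coordField p u) ((extChartAt 𝓘(ℝ, E) p).symm x) = 0 := by
      rw [← h1, ← h2]
      exact key
    have c1 : (fun y ↦ (inner ℝ (ξ y) (coordField p u y) : ℝ)) =
      fun y ↦ inner ℝ (coordField p u y) (ξ y) := funext fun y ↦ real_inner_comm _ _
    have c2 : (fun y ↦ (inner ℝ (ξ y) (coordField p v y) : ℝ)) =
      fun y ↦ inner ℝ (coordField p v y) (ξ y) := funext fun y ↦ real_inner_comm _ _
    have c3 : (fun y ↦ (inner ℝ (coordField p v y) (coordField p u y) : ℝ)) =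
      fun y ↦ inner ℝ (coordField p u y) (coordField p v y) := funext fun y ↦ real_inner_comm _ _
    have d := mvfderiv_inner_coordField p u v (chartField p ξ x) hx
    rw [chartFrame_chartField p ξ hx] at d
    simp only [koszul, c1, c2, c3, mlieBracket_swap_apply (V := ξ),
      mlieBracket_swap_apply (V := coordField p v) (W := coordField p u), inner_neg_left, d,
      mlieBracket_coordField p _ hx (hξ.1 _)] at key'
    simp only [coordField_chart_symm p _ hx] at key'
    rw [chartMetric_apply, chartMetric_apply, real_inner_comm _ (chartFrame p x u)]
    linarith

/-- `Γ` is the component vector of `∇_V V` for the coordinate field `V` with coefficients `v`.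
Coordinate fields commute, so the Koszul expression reduces to derivatives of the metric. Describing
`Γ` by its pairings with the metric avoids inverting the metric to write Christoffel symbols. -/
theorem hessian_chart {f : M → ℝ} (hf : ContMDiff 𝓘(ℝ, E) 𝓘(ℝ) ∞ f) (v : E)
    (hx : x ∈ (extChartAt 𝓘(ℝ, E) p).target) :
    ∃ Γ, (∀ w, chartMetric p x Γ w = fderiv ℝ (chartMetric p) x v v w
        - 1 / 2 * fderiv ℝ (chartMetric p) x w v v) ∧
      hessian 𝓘(ℝ, E) f ((extChartAt 𝓘(ℝ, E) p).symm x) (chartFrame p x v) (chartFrame p x v) =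
        fderiv ℝ (fderiv ℝ (f ∘ (extChartAt 𝓘(ℝ, E) p).symm)) x v v
          - fderiv ℝ (f ∘ (extChartAt 𝓘(ℝ, E) p).symm) x Γ := by
  set ψ := extChartAt 𝓘(ℝ, E) p
  have hy : ψ.symm x ∈ (chartAt E p).source := by
    simpa [ψ] using (extChartAt 𝓘(ℝ, E) p).map_target hx
  have hmd (w : E) := (contMDiffAt_coordField p w hy).mdifferentiableAt (by simp)
  have hbr (w : E) : mlieBracket 𝓘(ℝ, E) (coordField p v) (coordField p w) (ψ.symm x) = 0 := by
    rw [mlieBracket_coordField p v hx (contMDiffAt_coordField p w hy)]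
    have hconst : chartField p (coordField p w) =ᶠ[𝓝 x] fun _ ↦ w := by
      filter_upwards [(isOpen_extChartAt_target p).mem_nhds hx] with z hz
      exact chartField_coordField p w hz
    rw [hconst.fderiv_eq, fderiv_const_apply, zero_apply]
    exact map_zero _
  refine ⟨chartField p (fun y ↦ leviCivita 𝓘(ℝ, E) M (coordField p v) y (coordField p v y)) x,
    fun w ↦ ?_, ?_⟩
  · rw [chartMetric_apply, chartFrame_chartField p _ hx, ← coordField_chart_symm p w hx]
    have h1 := inner_leviCivitaFun (hmd v) (hmd v) (hmd w)
    refine h1.trans ?_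
    simp only [koszul, hbr, inner_zero_left]
    rw [coordField_chart_symm p v hx, coordField_chart_symm p w hx,
      mvfderiv_inner_coordField p v w v hx, mvfderiv_inner_coordField p v v w hx]
    ring
  · rw [← coordField_chart_symm p v hx, hessian_apply hf (hmd v),
      coordField_chart_symm p v hx]
    have hf' (y : M) := hf.mdifferentiable (by simp) y
    have hF : ContDiffAt ℝ ∞ (f ∘ ψ.symm) x :=
      ((hf _).comp x (contMDiffAt_chart_symm p hx)).contDiffAt
    have hDF := ((hF.fderiv_right (m := ∞) (by simp)).differentiableAt (by simp)).hasFDerivAt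
    have heq : ((fun y ↦ mvfderiv 𝓘(ℝ, E) f y (coordField p v y)) ∘ ψ.symm) =ᶠ[𝓝 x]
        fun z ↦ fderiv ℝ (f ∘ ψ.symm) z v := by
      filter_upwards [(isOpen_extChartAt_target p).mem_nhds hx] with z hz
      rw [Function.comp_apply, coordField_chart_symm p v hz]
      exact mvfderiv_chartFrame p hz (hf' _) v
    rw [mvfderiv_chartFrame p hx (mdifferentiableAt_mvfderiv_apply hf (hmd v)), heq.fderiv_eq,
      (hDF.clm_apply (hasFDerivAt_const v x)).fderiv, ← mvfderiv_chartFrame p hx (hf' _),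
      chartFrame_chartField p _ hx, coordField_chart_symm p v hx]
    simp [ψ]

end Chart
end Riemannian

/-! ### Local parametrizations of embedded submanifolds. -/

namespace Riemannian

/-- The parametrization is the inverse of the immersion's domain chart, read in the preferred chart
of `M`. Followed by the transition to the immersion's codomain chart it becomes the injective linear
map `s ↦ h.equiv (s, 0)`, so its own derivative is injective. -/
theorem IsEmbeddedSubmanifold.exists_parametrization {E : Type*} [NormedAddCommGroup E]
    [NormedSpace ℝ E] {M : Type*} [TopologicalSpace M] [ChartedSpace E M]
    [IsManifold 𝓘(ℝ, E) ∞ M] {k : ℕ} {S : Set M} (hS : IsEmbeddedSubmanifold 𝓘(ℝ, E) k S)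
    {p : M} (hp : p ∈ S) :
    ∃ (φ : EuclideanSpace ℝ (Fin k) → E) (t : EuclideanSpace ℝ (Fin k)),
      ContDiffAt ℝ ∞ φ t ∧ φ t = extChartAt 𝓘(ℝ, E) p p ∧ Function.Injective (fderiv ℝ φ t) ∧
      ∀ᶠ s in 𝓝 t, φ s ∈ (extChartAt 𝓘(ℝ, E) p).target ∧
        (extChartAt 𝓘(ℝ, E) p).symm (φ s) ∈ S := by
  obtain ⟨_, _, hemb⟩ := hS
  have h := hemb.isImmersion.isImmersionAt ⟨p, hp⟩
  set d := h.domChart with hd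
  set c := h.codChart with hc
  set ψ := extChartAt 𝓘(ℝ, E) p with hψ
  have hds : (⟨p, hp⟩ : S) ∈ d.source := h.mem_domChart_source
  have hdt : d ⟨p, hp⟩ ∈ d.target := d.map_source hds
  have hdinv : d.symm (d ⟨p, hp⟩) = ⟨p, hp⟩ := d.left_inv hds
  have hdsymm : ContMDiffAt (𝓡 k) (𝓡 k) ∞ d.symm (d ⟨p, hp⟩) :=
    contMDiffAt_symm_of_mem_maximalAtlas h.domChart_mem_maximalAtlas hdt
  have hval : ContMDiffAt (𝓡 k) 𝓘(ℝ, E) ∞ (Subtype.val ∘ d.symm) (d ⟨p, hp⟩) :=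
    (hemb.contMDiff.contMDiffAt).comp _ hdsymm
  have hval0 : (Subtype.val ∘ d.symm) (d ⟨p, hp⟩) = p := by simp [hdinv]
  have hφ : ContDiffAt ℝ ∞ (ψ ∘ Subtype.val ∘ d.symm) (d ⟨p, hp⟩) := by
    refine (ContMDiffAt.comp _ ?_ hval).contDiffAt
    rw [hval0]
    exact contMDiffAt_extChartAt
  have hnear : ∀ᶠ s in 𝓝 (d ⟨p, hp⟩), (d.symm s : M) ∈ ψ.source := by
    refine hval.continuousAt.eventually ?_
    rw [hval0]
    exact extChartAt_source_mem_nhds p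
  have hφ0 : (ψ ∘ Subtype.val ∘ d.symm) (d ⟨p, hp⟩) = ψ p := by
    rw [Function.comp_apply, hval0]
  refine ⟨ψ ∘ Subtype.val ∘ d.symm, d ⟨p, hp⟩, hφ, hφ0, ?_, ?_⟩
  · have hcψ : DifferentiableAt ℝ (c ∘ ψ.symm) (ψ p) := by
      have h1 : ContMDiffAt 𝓘(ℝ, E) 𝓘(ℝ, E) ∞ c (ψ.symm (ψ p)) := by
        rw [extChartAt_to_inv]
        exact contMDiffAt_of_mem_maximalAtlas h.codChart_mem_maximalAtlas h.mem_codChart_source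
      exact ((h1.comp _ (contMDiffAt_chart_symm p (mem_extChartAt_target p))).contDiffAt).differentiableAt
        (by simp)
    have heq : (c ∘ ψ.symm) ∘ (ψ ∘ Subtype.val ∘ d.symm) =ᶠ[𝓝 (d ⟨p, hp⟩)]
        fun s ↦ h.equiv (s, 0) := by
      filter_upwards [hnear, d.open_target.mem_nhds hdt] with s hs hst
      have hst' : s ∈ (d.extend (𝓡 k)).target := by simpa using hst
      have h1 := h.writtenInCharts hst'
      simp only [Function.comp_apply, ψ.left_inv hs]
      simpa using h1
    have hR : HasFDerivAt (fun s ↦ h.equiv (s, 0))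
        ((h.equiv : (EuclideanSpace ℝ (Fin k) × h.complement) →L[ℝ] E).comp
          (.inl ℝ (EuclideanSpace ℝ (Fin k)) h.complement)) (d ⟨p, hp⟩) :=
      ((h.equiv : (EuclideanSpace ℝ (Fin k) × h.complement) →L[ℝ] E).comp
        (.inl ℝ (EuclideanSpace ℝ (Fin k)) h.complement)).hasFDerivAt
    have hL := fderiv_comp (d ⟨p, hp⟩) (by rwa [hφ0]) (hφ.differentiableAt (by simp))
    rw [heq.fderiv_eq, hR.fderiv, hφ0] at hL
    have hinj : Function.Injective
        ((h.equiv : (EuclideanSpace ℝ (Fin k) × h.complement) →L[ℝ] E).comp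
          (.inl ℝ (EuclideanSpace ℝ (Fin k)) h.complement)) :=
      h.equiv.injective.comp (LinearMap.inl_injective (R := ℝ))
    rw [hL] at hinj
    exact Function.Injective.of_comp hinj
  · filter_upwards [hnear] with s hs
    refine ⟨ψ.map_source hs, ?_⟩
    simp only [Function.comp_apply, ψ.left_inv hs]
    exact (d.symm s).2

end Riemannian

/-! ### The contradiction at a maximum on a closed bolt. -/

theorem mainTheorem7 {M : Type*} [TopologicalSpace M] [T2Space M]
    [ChartedSpace (EuclideanSpace ℝ (Fin 4)) M] [IsManifold (𝓡 4) ∞ M]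
    [RiemannianBundle (fun x : M ↦ TangentSpace (𝓡 4) x)]
    [IsContMDiffRiemannianBundle (𝓡 4) ∞ (EuclideanSpace ℝ (Fin 4))
      (fun x : M ↦ TangentSpace (𝓡 4) x)]
    (h : ∃ f : M → ℝ, Riemannian.IsStrictlyConvex (𝓡 4) f) :
    ¬ ∃ (ξ : Π x : M, TangentSpace (𝓡 4) x) (S : Set M),
      Riemannian.IsKillingField ξ ∧ Riemannian.IsBolt ξ S ∧ IsCompact S := by
  rintro ⟨ξ, S, hξ, ⟨⟨p₀, hp₀, rfl⟩, hS⟩, hcompact⟩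
  obtain ⟨f, hf, hconv⟩ := h
  obtain ⟨p, hp, hmax⟩ := hcompact.exists_isMaxOn ⟨p₀, mem_connectedComponentIn hp₀⟩
    hf.continuous.continuousOn
  obtain ⟨φ, t, hφ, hφt, hinj, hev⟩ := hS.exists_parametrization hp
  set ψ := extChartAt (𝓡 4) p with hψ
  have hx : ψ p ∈ ψ.target := mem_extChartAt_target p
  have hinv : ψ.symm (ψ p) = p := extChartAt_to_inv p
  have hF : ContDiffAt ℝ ∞ (f ∘ ψ.symm) (ψ p) :=
    ((hf _).comp _ (Riemannian.contMDiffAt_chart_symm p hx)).contDiffAt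
  obtain ⟨v, hv, hle⟩ := (Riemannian.isKillingOn_chart p hξ).exists_hessian_nonpos hx
    (by simp) (by simp) (hF.of_le ENat.LEInfty.out) (hφ.of_le ENat.LEInfty.out) hφt hinj
    (by
      filter_upwards [hev] with s hs
      have h0 : ψ.symm (φ s) ∈ {x | ξ x = 0} := connectedComponentIn_subset _ _ hs.2
      exact (Riemannian.chartField_eq_zero_iff p hs.1).2 h0)
    (by
      filter_upwards [hev] with s hs
      have h1 : f (ψ.symm (φ s)) ≤ f p := hmax hs.2
      simpa only [Function.comp_apply, hφt, hinv] using h1)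
    -- If `ξ` vanishes near `p`, the image of a small coordinate ball is a connected set of zeros
    -- through `p`, hence lies in the bolt, and the maximum over the bolt is a local maximum on `M`.
    -- This treats the degenerate case without having to show that a surface has empty interior.
    (fun hzero ↦ by
      obtain ⟨r, hr, hball⟩ := Metric.eventually_nhds_iff_ball.1
        (hzero.and ((isOpen_extChartAt_target p).eventually_mem hx))
      have hsub : ψ.symm '' Metric.ball (ψ p) r ⊆ connectedComponentIn {x | ξ x = 0} p₀ := by
        rw [connectedComponentIn_eq hp]
        refine IsPreconnected.subset_connectedComponentIn ?_
          ⟨ψ p, Metric.mem_ball_self hr, hinv⟩ ?_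
        · exact (convex_ball _ _).isPreconnected.image _
            ((continuousOn_extChartAt_symm p).mono fun y hy ↦ (hball y hy).2)
        · rintro _ ⟨y, hy, rfl⟩
          exact (Riemannian.chartField_eq_zero_iff p (hball y hy).2).1 (hball y hy).1
      filter_upwards [Metric.ball_mem_nhds (ψ p) hr] with y hy
      have h1 : f (ψ.symm y) ≤ f p := hmax (hsub ⟨y, hy, rfl⟩)
      simpa only [Function.comp_apply, hinv] using h1)
  obtain ⟨Γ, hΓ, hhess⟩ := Riemannian.hessian_chart p hf v hx
  have h1 := hconv _ (Riemannian.chartFrame p (ψ p) v)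
    fun h0 ↦ hv (Riemannian.chartFrame_injective p hx (h0.trans (map_zero _).symm))
  exact absurd (hle Γ hΓ) (by rw [← hhess]; exact h1.not_ge)
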